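/- Let $(R,\mathfrak m)$ be a regular local ring of dimension $n$ and of prime characteristic $p>0$, let $x_1,\dots,x_n$ be a regular system of parameters of $R$, and let $\mathfrak a$ be an ideal with $(0)\neq\mathfrak a\subseteq\mathfrak m$. Let $E=H^n_{\mathfrak m}(R)$ be the top local cohomology module, represented by the Čech complex on $x_1,\dots,x_n$ as $$E=R_{x_1\cdots x_n}\Big/\sum_{i=1}^n R_{x_1\cdots\widehat{x_i}\cdots x_n},$$ and let $F_E\colon E\to E$ be its Frobenius morphism, $F_E([u/(x_1\cdots x_n)^d])=[u^p/(x_1\cdots x_n)^{pd}]$. For a real number $c>0$ put $$Z_c=\bigcap_{e\geq 1}\ker\big(\mathfrak a^{\lceil cp^e\rceil}F_E^e\big),\qquad \ker(\mathfrak a^{r}F_E^e)=\{w\in E\mid hF_E^e(w)=0\ \text{for all}\ h\in\mathfrak a^{r}\}.$$ Call an $R$-submodule $N\subseteq E$ invariant if $hF_E^e(N)\subseteq N$ for all $e\geq 1$ and all $h\in\mathfrak a^{\lceil cp^e\rceil}$. Then, for every real $c>0$, $Z_c$ is the unique maximal proper invariant submodule of $E$. That is, $Z_c$ is a proper invariant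 submodule of $E$, it contains every proper invariant submodule of $E$, and it is the only maximal element (with respect to inclusion) of the set of proper invariant submodules of $E$. -/

import Mathlib

open IsLocalRing

noncomputable section

namespace TopCech

variable {R : Type*} [CommRing R] {n : ℕ}

/-- The ring `R_{x_1 ⋯ x_n}`. -/
abbrev TopRing (x : Fin n → R) : Type _ := Localization.Away (∏ j, x j)

/-- The ring `R_{x_1 ⋯ x̂_i ⋯ x_n}`, the `i`-th element being omitted. -/
abbrev FaceRing (x : Fin n → R) (i : Fin n) : Type _ :=
  Localization.Away (∏ j ∈ Finset.univ.erase i, x j)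

theorem isUnit_face (x : Fin n → R) (i : Fin n)
    (y : Submonoid.powers (∏ j ∈ Finset.univ.erase i, x j)) :
    IsUnit (Algebra.ofId R (TopRing x) y) := by
  obtain ⟨_, d, rfl⟩ := y
  simp only [map_pow]
  refine IsUnit.pow d ?_
  have h : IsUnit (algebraMap R (TopRing x) (∏ j, x j)) :=
    IsLocalization.Away.algebraMap_isUnit _
  exact isUnit_of_dvd_unit
    (map_dvd _ (Finset.prod_dvd_prod_of_subset _ _ x (Finset.erase_subset i Finset.univ))) h

/-- The canonical map `R_{x_1 ⋯ x̂_i ⋯ x_n} → R_{x_1 ⋯ x_n}`. -/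
def faceMap (x : Fin n → R) (i : Fin n) : FaceRing x i →ₐ[R] TopRing x :=
  IsLocalization.liftAlgHom (M := Submonoid.powers (∏ j ∈ Finset.univ.erase i, x j))
    (f := Algebra.ofId R (TopRing x)) (isUnit_face x i)

/-- The `R`-submodule `∑ i, R_{x_1 ⋯ x̂_i ⋯ x_n}` of `R_{x_1 ⋯ x_n}`. -/
def boundary (x : Fin n → R) : Submodule R (TopRing x) :=
  ⨆ i, LinearMap.range (faceMap x i).toLinearMap

/-- The top cohomology `R_{x_1 ⋯ x_n} / ∑ i, R_{x_1 ⋯ x̂_i ⋯ x_n}` of the Čech complex of `R` on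
`x_1, …, x_n`. If `R` is a Noetherian local ring and `x_1, …, x_n` generate an ideal that is primary
to the maximal ideal `𝔪`, this is the local cohomology module `H^n_𝔪(R)`. -/
abbrev E (x : Fin n → R) : Type _ := TopRing x ⧸ boundary x

/-- The class `[u / (x_1 ⋯ x_n)^d]` in `E`. -/
def cls (x : Fin n → R) (u : R) (d : ℕ) : E x :=
  Submodule.Quotient.mk (Localization.mk u ⟨(∏ j, x j) ^ d, d, rfl⟩)

variable (p : ℕ) [ExpChar R p]

theorem powers_le_comap_frobenius (f : R) :
    Submonoid.powers f ≤ (Submonoid.powers f).comap (frobenius R p) := by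
  rintro _ ⟨d, rfl⟩
  exact ⟨d * p, by simp [frobenius_def, pow_mul]⟩

/-- The Frobenius `u / f ^ d ↦ u ^ p / f ^ (p * d)` of a localization `R_f`. -/
def frobAway (f : R) : Localization.Away f →+* Localization.Away f :=
  IsLocalization.map (Localization.Away f) (frobenius R p) (powers_le_comap_frobenius p f)

theorem frobAway_eq_pow (f : R) (z : Localization.Away f) : frobAway p f z = z ^ p := by
  obtain ⟨u, s, rfl⟩ := IsLocalization.exists_mk'_eq (Submonoid.powers f) z
  rw [frobAway, IsLocalization.map_mk', ← IsLocalization.mk'_pow]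
  rfl

/-- The Frobenius of `R_{x_1 ⋯ x_n}`, as a map that is semilinear over the Frobenius of `R`. -/
def frobTop (x : Fin n → R) : TopRing x →ₛₗ[frobenius R p] TopRing x where
  toFun := frobAway p (∏ j, x j)
  map_add' := map_add _
  map_smul' r z := by
    simp only [frobAway_eq_pow, Algebra.smul_def, mul_pow, frobenius_def, map_pow]

theorem boundary_le_comap (x : Fin n → R) :
    boundary x ≤ (boundary x).comap (frobTop p x) := by
  refine iSup_le fun i => ?_
  rintro _ ⟨z, rfl⟩
  refine Submodule.mem_iSup_of_mem i ⟨z ^ p, ?_⟩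
  change faceMap x i (z ^ p) = frobAway p _ (faceMap x i z)
  rw [frobAway_eq_pow, map_pow]

/-- The Frobenius morphism `F_E` of `E`: it sends `[u / (x_1 ⋯ x_n)^d]` to
`[u^p / (x_1 ⋯ x_n)^(p d)]`. -/
def FE (x : Fin n → R) : E x →ₛₗ[frobenius R p] E x :=
  Submodule.mapQ (boundary x) (boundary x) (frobTop p x) (boundary_le_comap p x)

theorem FE_cls (x : Fin n → R) (u : R) (d : ℕ) :
    FE p x (cls x u d) = cls x (u ^ p) (p * d) := by
  change Submodule.Quotient.mk (frobAway p _ _) = _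
  rw [frobAway_eq_pow, Localization.mk_pow, cls]
  congr 2
  ext
  simp [← pow_mul, mul_comm]

theorem iterate_FE_zero (x : Fin n → R) (e : ℕ) : (FE p x)^[e] 0 = 0 :=
  iterate_map_zero _ _

theorem iterate_FE_add (x : Fin n → R) (e : ℕ) (v w : E x) :
    (FE p x)^[e] (v + w) = (FE p x)^[e] v + (FE p x)^[e] w :=
  iterate_map_add _ _ _ _

theorem iterate_FE_smul (x : Fin n → R) (e : ℕ) (g : R) (w : E x) :
    (FE p x)^[e] (g • w) = g ^ p ^ e • (FE p x)^[e] w := by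
  induction e with
  | zero => simp
  | succ e ih =>
    rw [Function.iterate_succ_apply', Function.iterate_succ_apply', ih, LinearMap.map_smulₛₗ,
      frobenius_def, ← pow_mul, pow_succ]

/-- `Z_{r,e} = Ker (𝔞^r F_E^e) = {w ∈ E | h F_E^e(w) = 0 for all h ∈ 𝔞^r}`. -/
def kerPow (x : Fin n → R) (a : Ideal R) (r e : ℕ) : Submodule R (E x) where
  carrier := {w | ∀ h ∈ a ^ r, h • (FE p x)^[e] w = 0}
  zero_mem' h _ := by rw [iterate_FE_zero, smul_zero]
  add_mem' hv hw h hh := by rw [iterate_FE_add, smul_add, hv h hh, hw h hh, add_zero]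
  smul_mem' g w hw h hh := by rw [iterate_FE_smul, smul_comm, hw h hh, smul_zero]

/-- `Z_c = ⋂_{e ≥ 1} Z_{⌈c p^e⌉, e}`. -/
def Z (x : Fin n → R) (a : Ideal R) (c : ℝ) : Submodule R (E x) :=
  ⨅ (e : ℕ) (_ : 1 ≤ e), kerPow p x a ⌈c * (p : ℝ) ^ e⌉₊ e

/-- `N` is invariant under all the maps `h F_E^e` with `e ≥ 1` and `h ∈ 𝔞^⌈c p^e⌉`. -/
def IsInvariant (x : Fin n → R) (a : Ideal R) (c : ℝ) (N : Submodule R (E x)) : Prop :=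
  ∀ e : ℕ, 1 ≤ e → ∀ h ∈ a ^ ⌈c * (p : ℝ) ^ e⌉₊, ∀ w ∈ N, h • (FE p x)^[e] w ∈ N

end TopCech

end

/-! Let η = [1/(x₁⋯xₙ)]. Every nonzero element of E has η as a multiple
(`exists_smul_eq_cls_one_one_of_ne_zero`), and the classes F^k(η) = [1/(x₁⋯xₙ)^(p^k)] generate E
(`eq_top_of_forall_cls_one_mem`).

If N is invariant and not inside Z_c, some hF^e(w) with w ∈ N and h ∈ 𝔞^⌈cp^e⌉ is nonzero, so η =
r·hF^e(w). Then F^k(η) = r^(p^k) h^(p^k) F^(k+e)(w), and h^(p^k) ∈ 𝔞^⌈cp^(k+e)⌉, so F^k(η) ∈ N for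
all k and N = E. The same composition rule makes Z_c invariant.

Properness uses regularity: [u/(x₁⋯xₙ)^(d+1)] = 0 forces u ∈ (xᵢ^(d+1))
(`mem_spanPow_of_cls_eq_zero`). If Z_c = E, every h ∈ 𝔞^⌈cp⌉ lies in all powers of 𝔪, so h = 0 by
Krull, whereas 𝔞 ≠ 0 in a domain. -/

/-! ### Regular local rings are domains. -/

theorem Ideal.map_mk_span_of_coeff_isUnit {R : Type*} [CommRing R] [DecidableEq R] {s : Finset R}
    {f : R → R} {y z : R} (hz : ∑ a ∈ s, f a * a = z) (hy : y ∈ s) (hu : IsUnit (f y)) :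
    (Ideal.span (s : Set R)).map (Ideal.Quotient.mk (Ideal.span {z})) =
      Ideal.span (Ideal.Quotient.mk (Ideal.span {z}) '' (s.erase y : Finset R)) := by
  set φ := Ideal.Quotient.mk (Ideal.span {z})
  rw [Ideal.map_span]
  refine le_antisymm (Ideal.span_le.2 ?_)
    (Ideal.span_mono (Set.image_mono (by exact_mod_cast Finset.erase_subset y s)))
  have hsub : ∀ a ∈ s.erase y, φ a ∈ Ideal.span (φ '' (s.erase y : Finset R)) := fun a ha =>
    Ideal.subset_span ⟨a, ha, rfl⟩
  rintro _ ⟨a, ha, rfl⟩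
  by_cases hay : a = y
  · subst hay
    have h0 : φ z = 0 := Ideal.Quotient.eq_zero_iff_mem.2 (Ideal.mem_span_singleton_self z)
    have h1 := congrArg φ hz
    rw [h0, ← Finset.add_sum_erase s _ hy, map_add, map_mul, map_sum] at h1
    refine (Ideal.unit_mul_mem_iff_mem _ (hu.map φ)).1 ?_
    rw [eq_neg_of_add_eq_zero_left h1]
    refine neg_mem (_root_.sum_mem fun b hb => ?_)
    rw [map_mul]
    exact Ideal.mul_mem_left _ _ (hsub b hb)
  · exact hsub a (Finset.mem_erase.2 ⟨hay, ha⟩)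

theorem WithBot.natCast_le_of_le_add_natCast {a b c : ℕ} {d : WithBot ℕ∞}
    (h : (c : WithBot ℕ∞) ≤ d + b) (hc : a + b ≤ c) : (a : WithBot ℕ∞) ≤ d := by
  induction d with
  | bot => exact absurd (h.trans_eq (WithBot.bot_add _)) (by simp)
  | coe d =>
    induction d with
    | top => exact_mod_cast le_top
    | coe d =>
      norm_cast at h ⊢
      lia

theorem IsLocalRing.ringKrullDim_eq_zero_of_mem_minimalPrimes {R : Type*} [CommRing R]
    [IsLocalRing R] (h : maximalIdeal R ∈ minimalPrimes R) : ringKrullDim R = 0 := by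
  rw [← maximalIdeal_height_eq_ringKrullDim, Ideal.height_eq_zero_iff.2 h]; rfl

/-- Prime avoidance gives z ∈ 𝔪 outside 𝔪² and all minimal primes. Modulo z one generator becomes
redundant and the dimension drops by at most one, so (z) is prime by induction. A minimal prime q ⊆
(z) satisfies q = zq, hence q = 0 by Nakayama. -/
theorem IsLocalRing.isDomain_of_card_le_ringKrullDim (n : ℕ) :
    ∀ {R : Type*} [CommRing R] [IsLocalRing R] [IsNoetherianRing R] (s : Finset R),
      Ideal.span (s : Set R) = maximalIdeal R → s.card ≤ n → (n : WithBot ℕ∞) ≤ ringKrullDim R →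
      IsDomain R := by
  induction n with
  | zero =>
    intro R _ _ _ s hs hn _
    obtain rfl : s = ∅ := by simpa using hn
    have : IsField R := by
      rw [isField_iff_maximalIdeal_eq, ← hs]
      simp
    exact this.isDomain
  | succ n ih =>
    intro R _ _ _ s hs hn hdim
    classical
    have hmin : maximalIdeal R ∉ minimalPrimes R := fun h => by
      rw [ringKrullDim_eq_zero_of_mem_minimalPrimes h] at hdim
      norm_cast at hdim
    have hJ : maximalIdeal R ≤ (⊥ : Ideal R).jacobson := by
      rw [jacobson_eq_maximalIdeal _ bot_ne_top]
    -- an element of the maximal ideal that is neither in its square nor in a minimal prime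
    obtain ⟨z, hzm, hz⟩ : ∃ z ∈ maximalIdeal R, z ∉ maximalIdeal R ^ 2 ∧
        ∀ q ∈ minimalPrimes R, z ∉ q := by
      by_contra! hcon
      have hsub : (maximalIdeal R : Set R) ⊆
          ⋃ q ∈ insert (maximalIdeal R ^ 2) (minimalPrimes R), ((id q : Ideal R) : Set R) := by
        intro z hz
        simp only [Set.mem_iUnion, exists_prop, id]
        by_cases hz2 : z ∈ maximalIdeal R ^ 2
        · exact ⟨_, Set.mem_insert _ _, hz2⟩
        · obtain ⟨q, hq, hzq⟩ := hcon z hz hz2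
          exact ⟨q, Set.mem_insert_of_mem _ hq, hzq⟩
      -- Prime avoidance tolerates two exceptional ideals; 𝔪² fills both slots.
      obtain ⟨q, hq, hle⟩ := (Ideal.subset_union_prime_finite
        ((minimalPrimes.finite_of_isNoetherianRing R).insert _)
        (maximalIdeal R ^ 2) (maximalIdeal R ^ 2) (fun q hq h _ =>
          (Set.mem_of_mem_insert_of_ne hq h).1.1)).1 hsub
      rcases hq with rfl | hq
      · have hbot : maximalIdeal R = ⊥ :=
          Submodule.eq_bot_of_le_smul_of_le_jacobson_bot (maximalIdeal R) _
            (IsNoetherian.noetherian _) (by simpa [pow_two] using hle) hJ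
        refine hmin ⟨⟨inferInstance, bot_le⟩, fun q _ _ => ?_⟩
        rw [hbot]
        exact bot_le
      · have : q.IsPrime := hq.1.1
        exact hmin (le_antisymm hle (le_maximalIdeal this.ne_top) ▸ hq)
    obtain ⟨hz2, hzq⟩ := hz
    have hzs := hzm
    rw [← hs] at hzs
    obtain ⟨f, -, hf⟩ := Submodule.mem_span_finset.1 hzs
    simp only [smul_eq_mul] at hf
    obtain ⟨y, hy, hu⟩ : ∃ y ∈ s, IsUnit (f y) := by
      by_contra! hcon
      refine hz2 (hf ▸ sum_mem fun b hb => ?_)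
      rw [pow_two]
      exact Ideal.mul_mem_mul ((mem_maximalIdeal _).2 (hcon b hb))
        (hs ▸ Ideal.subset_span hb)
    have hmap := Ideal.map_mk_span_of_coeff_isUnit hf hy hu
    rw [hs] at hmap
    have hne : Ideal.span {z} ≠ ⊤ := fun h =>
      (maximalIdeal.isMaximal R).ne_top (top_le_iff.1 (h ▸ (Ideal.span_singleton_le_iff_mem _).2 hzm))
    have : Nontrivial (R ⧸ Ideal.span {z}) := Ideal.Quotient.nontrivial_iff.2 hne
    have : IsLocalRing (R ⧸ Ideal.span {z}) :=
      IsLocalRing.of_surjective' (Ideal.Quotient.mk _) Ideal.Quotient.mk_surjective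
    rw [map_maximalIdeal_of_surjective _ Ideal.Quotient.mk_surjective] at hmap
    have hd : (n : WithBot ℕ∞) ≤ ringKrullDim (R ⧸ Ideal.span {z}) := by
      have h1 := ringKrullDim_le_ringKrullDim_quotient_add_card ({z} : Finset R)
        (by simpa [IsLocalRing.ringJacobson_eq_maximalIdeal] using hzm)
      rw [Finset.coe_singleton, Finset.card_singleton] at h1
      exact WithBot.natCast_le_of_le_add_natCast (hdim.trans h1) le_rfl
    rw [← Finset.coe_image] at hmap
    have : IsDomain (R ⧸ Ideal.span {z}) := ih _ hmap.symm
      (Finset.card_image_le.trans (by rw [Finset.card_erase_of_mem hy]; lia)) hd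
    have hprime : (Ideal.span {z}).IsPrime := (Ideal.Quotient.isDomain_iff_prime _).1 this
    obtain ⟨q, hq, hqz⟩ := Ideal.exists_minimalPrimes_le (bot_le : ⊥ ≤ Ideal.span {z})
    have hqp : q.IsPrime := hq.1.1
    have hq0 : q = ⊥ := by
      refine Submodule.eq_bot_of_le_smul_of_le_jacobson_bot (Ideal.span {z}) _
        (IsNoetherian.noetherian _) (fun b hb => ?_)
        (((Ideal.span_singleton_le_iff_mem _).2 hzm).trans hJ)
      obtain ⟨t, rfl⟩ := Ideal.mem_span_singleton.1 (hqz hb)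
      exact Submodule.smul_mem_smul (Ideal.mem_span_singleton_self z)
        ((hqp.mem_or_mem hb).resolve_left (hzq q hq))
    rw [hq0] at hqp
    exact IsDomain.of_bot_isPrime R

/-! ### Regular systems of parameters. -/

section RegularSystem

variable {R : Type*} [CommRing R] [IsLocalRing R] [IsNoetherianRing R] {n : ℕ} {x : Fin n → R}

/-- The quotient has dimension at least n − |S|, and the remaining parameters generate its maximal
ideal, so it is a domain. -/
theorem IsLocalRing.isPrime_span_image (hn : ringKrullDim R = n)
    (hx : Ideal.span (Set.range x) = maximalIdeal R) (S : Finset (Fin n)) :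
    (Ideal.span (x '' S)).IsPrime := by
  classical
  have hle : Ideal.span (x '' S) ≤ maximalIdeal R :=
    hx ▸ Ideal.span_mono (Set.image_subset_range _ _)
  have : Nontrivial (R ⧸ Ideal.span (x '' S)) := Ideal.Quotient.nontrivial_iff.2
    (ne_top_of_le_ne_top (maximalIdeal.isMaximal R).ne_top hle)
  have : IsLocalRing (R ⧸ Ideal.span (x '' S)) :=
    IsLocalRing.of_surjective' (Ideal.Quotient.mk _) Ideal.Quotient.mk_surjective
  have hdim := ringKrullDim_le_ringKrullDim_quotient_add_card (S.image x)
    (by simpa [IsLocalRing.ringJacobson_eq_maximalIdeal] using Ideal.span_le.1 hle)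
  rw [Finset.coe_image, hn] at hdim
  rw [← Ideal.Quotient.isDomain_iff_prime]
  refine isDomain_of_card_le_ringKrullDim (n - S.card)
    (Sᶜ.image fun i => Ideal.Quotient.mk _ (x i)) ?_
    (Finset.card_image_le.trans (by rw [Finset.card_compl, Fintype.card_fin])) ?_
  · rw [← map_maximalIdeal_of_surjective _ Ideal.Quotient.mk_surjective, ← hx, Ideal.map_span]
    refine le_antisymm (Ideal.span_mono ?_) (Ideal.span_le.2 ?_)
    · rintro _ h
      obtain ⟨i, -, rfl⟩ := Finset.mem_image.1 h
      exact ⟨_, ⟨i, rfl⟩, rfl⟩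
    · rintro _ ⟨_, ⟨i, rfl⟩, rfl⟩
      by_cases hi : i ∈ S
      · rw [Ideal.Quotient.eq_zero_iff_mem.2 (Ideal.subset_span (Set.mem_image_of_mem x hi))]
        exact zero_mem _
      · exact Ideal.subset_span (Finset.mem_image_of_mem _ (Finset.mem_compl.2 hi))
  · have hcard : S.card ≤ n := by simpa using Finset.card_le_univ S
    have h2 : ((n : ℕ) : WithBot ℕ∞) ≤ ringKrullDim (R ⧸ Ideal.span (x '' S)) + (S.card : ℕ) :=
      hdim.trans (by gcongr; exact Finset.card_image_le)
    exact WithBot.natCast_le_of_le_add_natCast h2 (Nat.sub_add_cancel hcard).le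

/-- Otherwise n − 1 elements would generate 𝔪, fewer than the dimension. -/
theorem IsLocalRing.notMem_span_image (hn : ringKrullDim R = n)
    (hx : Ideal.span (Set.range x) = maximalIdeal R) {S : Finset (Fin n)} {j : Fin n}
    (hj : j ∉ S) : x j ∉ Ideal.span (x '' S) := by
  classical
  intro hmem
  have hm : Ideal.span (((Finset.univ.erase j).image x : Finset R) : Set R) = maximalIdeal R := by
    rw [← hx, Finset.coe_image]
    refine le_antisymm (Ideal.span_mono (Set.image_subset_range _ _)) (Ideal.span_le.2 ?_)
    rintro _ ⟨i, rfl⟩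
    by_cases hij : i = j
    · subst hij
      refine Ideal.span_mono (Set.image_mono fun k hk => ?_) hmem
      simpa using fun h : k = i => hj (h ▸ hk)
    · exact Ideal.subset_span ⟨i, by simpa using hij, rfl⟩
  have h1 := ringKrullDim_le_spanFinrank_maximalIdeal R
  have h2 := Submodule.spanFinrank_span_le_ncard_of_finite (R := R)
    ((Finset.univ.erase j).image x).finite_toSet
  rw [hn] at h1
  rw [Set.ncard_coe_finset] at h2
  change (Ideal.span _).spanFinrank ≤ _ at h2
  rw [hm] at h2
  have h3 : n ≤ (maximalIdeal R).spanFinrank := by exact_mod_cast h1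
  have h4 := h3.trans (h2.trans Finset.card_image_le)
  rw [Finset.card_erase_of_mem (Finset.mem_univ j), Finset.card_univ, Fintype.card_fin] at h4
  have := j.pos
  lia

theorem IsLocalRing.mem_span_image_of_mul_mem (hn : ringKrullDim R = n)
    (hx : Ideal.span (Set.range x) = maximalIdeal R) {S : Finset (Fin n)} {j : Fin n}
    (hj : j ∉ S) {u : R} (hu : x j * u ∈ Ideal.span (x '' S)) : u ∈ Ideal.span (x '' S) :=
  ((isPrime_span_image hn hx S).mem_or_mem hu).resolve_left (notMem_span_image hn hx hj)

end RegularSystem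

/-! ### Ideals generated by powers of the parameters. -/

/-- The ideal generated by the elements `x i ^ (a i + 1)` for `i ∈ S`. -/
def Ideal.spanPow {R ι : Type*} [CommRing R] (x : ι → R) (S : Finset ι) (a : ι → ℕ) : Ideal R :=
  Ideal.span ((fun i => x i ^ (a i + 1)) '' S)

namespace Ideal

section SpanPow

variable {R ι : Type*} [CommRing R] {x : ι → R} {S T : Finset ι} {a b : ι → ℕ}

theorem pow_mem_spanPow {i : ι} {k : ℕ} (hi : i ∈ S) (hk : a i + 1 ≤ k) :
    x i ^ k ∈ spanPow x S a :=
  (spanPow x S a).pow_mem_of_pow_mem (Ideal.subset_span (Set.mem_image_of_mem _ hi)) hk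

theorem spanPow_le_iff {I : Ideal R} : spanPow x S a ≤ I ↔ ∀ i ∈ S, x i ^ (a i + 1) ∈ I := by
  rw [spanPow, Ideal.span_le, Set.image_subset_iff]
  rfl

theorem spanPow_le_spanPow (hST : S ⊆ T) (hab : ∀ i ∈ S, b i ≤ a i) :
    spanPow x S a ≤ spanPow x T b :=
  spanPow_le_iff.2 fun i hi => pow_mem_spanPow (hST hi) (Nat.succ_le_succ (hab i hi))

theorem spanPow_eq_span_image (ha : ∀ i ∈ S, a i = 0) : spanPow x S a = Ideal.span (x '' S) := by
  rw [spanPow]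
  congr 1
  exact Set.image_congr fun i hi => by rw [ha i hi, zero_add, pow_one]

variable [DecidableEq ι]

theorem mem_spanPow_iff {i : ι} (hi : i ∈ S) {u : R} :
    u ∈ spanPow x S a ↔
      ∃ s, ∃ t ∈ spanPow x (S.erase i) a, u = s * x i ^ (a i + 1) + t := by
  conv_lhs => rw [← Finset.insert_erase hi]
  rw [spanPow, Finset.coe_insert, Set.image_insert_eq, Ideal.mem_span_insert]
  rfl

theorem spanPow_erase_update_le {i : ι} {m : ℕ} :
    spanPow x (S.erase i) (Function.update a i m) ≤ spanPow x (S.erase i) a :=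
  spanPow_le_spanPow subset_rfl fun j hj => by
    rw [Function.update_of_ne (Finset.ne_of_mem_erase hj)]

theorem sum_update_lt {i : ι} (hi : i ∈ S) {m : ℕ} (hm : m < a i) :
    ∑ j ∈ S, Function.update a i m j < ∑ j ∈ S, a j := by
  refine Finset.sum_lt_sum (fun j _ => ?_) ⟨i, hi, by rwa [Function.update_self]⟩
  rcases eq_or_ne j i with rfl | h
  · rw [Function.update_self]; exact hm.le
  · rw [Function.update_of_ne h]

/-- Multiplication by `x i ^ k` maps `spanPow x S (update a i m)` to `spanPow x S a` if
`a i ≤ m + k`. -/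
theorem mul_mem_spanPow_of_mem_update {i : ι} {m k : ℕ} (hk : a i ≤ m + k) {u : R}
    (hu : u ∈ spanPow x S (Function.update a i m)) : u * x i ^ k ∈ spanPow x S a := by
  have : spanPow x S (Function.update a i m) ≤
      Submodule.comap (LinearMap.mulRight R (x i ^ k)) (spanPow x S a) := by
    refine spanPow_le_iff.2 fun j hj => ?_
    rw [Submodule.mem_comap, LinearMap.mulRight_apply]
    rcases eq_or_ne j i with rfl | h
    · rw [Function.update_self, ← pow_add]
      exact pow_mem_spanPow hj (by lia)
    · rw [Function.update_of_ne h]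
      exact Ideal.mul_mem_right _ _ (pow_mem_spanPow hj le_rfl)
  exact this hu

theorem mem_of_pow_mul_mem {I : Ideal R} {y : R} (h : ∀ u, y * u ∈ I → u ∈ I) (k : ℕ) {u : R}
    (hu : y ^ k * u ∈ I) : u ∈ I := by
  induction k with
  | zero => simpa using hu
  | succ k ih => exact ih (h _ (by rwa [← mul_assoc, ← pow_succ']))

/-- The regularity assumed in `H` passes from the parameters to their powers, by induction on the
sum of the exponents. -/
theorem mem_spanPow_of_mul_mem
    (H : ∀ (S : Finset ι), ∀ j ∉ S, ∀ u, x j * u ∈ Ideal.span (x '' S) → u ∈ Ideal.span (x '' S))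
    (N : ℕ) : ∀ (S : Finset ι) (a : ι → ℕ), ∑ i ∈ S, a i < N → ∀ j ∉ S, ∀ u,
      x j * u ∈ spanPow x S a → u ∈ spanPow x S a := by
  induction N with
  | zero => intro S a h; exact absurd h (Nat.not_lt_zero _)
  | succ N ih =>
    intro S a hN j hj u hu
    by_cases h0 : ∀ i ∈ S, a i = 0
    · rw [spanPow_eq_span_image h0] at hu ⊢
      exact H S j hj u hu
    push Not at h0
    obtain ⟨i, hi, hai⟩ := h0
    obtain ⟨m, hm⟩ := Nat.exists_eq_add_one_of_ne_zero hai
    have ha1 := sum_update_lt (a := a) hi (m := m) (by lia)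
    have ha2 := sum_update_lt (a := a) hi (m := 0) (by lia)
    have ha3 : ∑ k ∈ S.erase i, a k < N := by
      have := Finset.add_sum_erase S a hi
      lia
    have hu1 := ih S _ (by lia) j hj u (spanPow_le_spanPow (b := Function.update a i m) subset_rfl
      (fun k _ => by
        rcases eq_or_ne k i with rfl | h
        · rw [Function.update_self]; lia
        · rw [Function.update_of_ne h]) hu)
    obtain ⟨s', t', ht', rfl⟩ := (mem_spanPow_iff hi).1 hu1
    rw [Function.update_self] at hu ⊢
    have ht'a := spanPow_erase_update_le ht'
    obtain ⟨s, t, ht, hst⟩ := (mem_spanPow_iff hi).1 hu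
    -- Comparing the two expansions of x_j u, cancel a power of xᵢ modulo the other powers; this
    -- puts x_j s' in the ideal with xᵢ to the first power.
    have h1 : x j * s' - x i * s ∈ spanPow x (S.erase i) a := by
      refine mem_of_pow_mul_mem (ih _ a ha3 i (Finset.notMem_erase i S)) (m + 1) ?_
      have : x i ^ (m + 1) * (x j * s' - x i * s) = t - x j * t' := by
        rw [hm] at hst
        linear_combination hst
      rw [this]
      exact sub_mem ht (Ideal.mul_mem_left _ _ ht'a)
    have h2 : s' ∈ spanPow x S (Function.update a i 0) := by
      refine ih S _ (by lia) j hj s' ((mem_spanPow_iff hi).2 ⟨s, x j * s' - x i * s, ?_, ?_⟩)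
      · refine spanPow_le_spanPow subset_rfl (fun k hk => ?_) h1
        rw [Function.update_of_ne (Finset.ne_of_mem_erase hk)]
      · rw [Function.update_self]; ring
    exact add_mem (mul_mem_spanPow_of_mem_update (by lia) h2)
      (spanPow_le_spanPow (Finset.erase_subset i S) (fun _ _ => le_rfl) ht'a)

/-- Cancelling xᵢ^k modulo the other powers, one index of T at a time, reduces to 1 ∉ (x). The case
of full T makes η nonzero. -/
theorem prod_pow_notMem_spanPow [Fintype ι]
    (H : ∀ (S : Finset ι), ∀ j ∉ S, ∀ u, x j * u ∈ Ideal.span (x '' S) → u ∈ Ideal.span (x '' S))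
    (hx : Ideal.span (Set.range x) ≠ ⊤) (k : ℕ) (T : Finset ι) :
    ∏ i ∈ T, x i ^ k ∉ spanPow x Finset.univ (fun i => if i ∈ T then k else 0) := by
  induction T using Finset.induction_on with
  | empty =>
    rw [spanPow_eq_span_image (by simp)]
    simpa [← Ideal.eq_top_iff_one] using hx
  | insert i T hi ih =>
    intro hmem
    obtain ⟨s, t, ht, hst⟩ := (mem_spanPow_iff (Finset.mem_univ i)).1 hmem
    simp only [Finset.mem_insert_self, if_true] at hst
    rw [Finset.prod_insert hi] at hst
    have h1 : x i ^ k * (∏ j ∈ T, x j ^ k - s * x i) = t := by linear_combination hst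
    have h2 := mem_of_pow_mul_mem (mem_spanPow_of_mul_mem H _ _ _ (Nat.lt_succ_self _) i
      (Finset.notMem_erase i Finset.univ)) k (h1 ▸ ht)
    refine ih ((mem_spanPow_iff (Finset.mem_univ i)).2 ⟨s, _, ?_,
      show _ = _ + (∏ j ∈ T, x j ^ k - s * x i) by rw [if_neg hi]; ring⟩)
    refine spanPow_le_spanPow subset_rfl (fun j hj => ?_) h2
    simp [Finset.ne_of_mem_erase hj]

/-- This makes the transition maps R/(xᵢ^(d+1)) → R/(xᵢ^(d+k+1)), whose direct limit is E, well
defined. -/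
theorem mul_prod_pow_mem_spanPow [Fintype ι] {d k : ℕ} {u : R}
    (hu : u ∈ spanPow x Finset.univ (fun _ => d)) :
    u * (∏ i, x i) ^ k ∈ spanPow x Finset.univ (fun _ => d + k) := by
  have : spanPow x Finset.univ (fun _ => d) ≤
      Submodule.comap (LinearMap.mulRight R ((∏ i, x i) ^ k))
        (spanPow x Finset.univ (fun _ => d + k)) := by
    refine spanPow_le_iff.2 fun j hj => ?_
    rw [Submodule.mem_comap, LinearMap.mulRight_apply, ← Finset.mul_prod_erase _ _ hj, mul_pow,
      ← mul_assoc, ← pow_add]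
    exact Ideal.mul_mem_right _ _ (pow_mem_spanPow hj (by lia))
  exact this hu

/-- The socle of `R / (x i ^ (a i + 1))` is essential and generated by `∏ i, x i ^ a i`. -/
theorem exists_mul_sub_prod_pow_mem_spanPow [Fintype ι] [IsLocalRing R]
    (hx : Ideal.span (Set.range x) = maximalIdeal R) (N : ℕ) :
    ∀ a : ι → ℕ, ∑ i, a i < N → ∀ u ∉ spanPow x Finset.univ a,
      ∃ r, r * u - ∏ i, x i ^ a i ∈ spanPow x Finset.univ a := by
  induction N with
  | zero => intro a h; exact absurd h (Nat.not_lt_zero _)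
  | succ N ih =>
    intro a hN u hu
    by_cases h0 : ∀ i ∈ Finset.univ, a i = 0
    · rw [spanPow_eq_span_image h0, Finset.coe_univ, Set.image_univ, hx, mem_maximalIdeal,
        mem_nonunits_iff, not_not] at hu
      obtain ⟨r, hr⟩ := hu.exists_left_inv
      refine ⟨r, ?_⟩
      rw [hr, Finset.prod_eq_one fun i hi => by rw [h0 i hi, pow_zero], sub_self]
      exact zero_mem _
    push Not at h0
    obtain ⟨i, hi, hai⟩ := h0
    obtain ⟨m, hm⟩ := Nat.exists_eq_add_one_of_ne_zero hai
    have ha1 := sum_update_lt (a := a) hi (m := m) (by lia)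
    have ha2 := sum_update_lt (a := a) hi (m := 0) (by lia)
    have hprod : ∀ l k, l + k = a i →
        (∏ j, x j ^ Function.update a i l j) * x i ^ k = ∏ j, x j ^ a j := by
      intro l k hlk
      rw [← Finset.mul_prod_erase _ _ hi, ← Finset.mul_prod_erase _ (fun j => x j ^ a j) hi,
        Function.update_self, ← hlk, pow_add, Finset.prod_congr rfl fun j hj => by
          rw [Function.update_of_ne (Finset.ne_of_mem_erase hj)]]
      ring
    -- Either u = s xᵢ^(aᵢ) + t, and s is treated with xᵢ to the first power, or u survives with the
    -- exponent of xᵢ lowered by one, and multiplying by xᵢ restores it.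
    by_cases hub : u ∈ spanPow x Finset.univ (Function.update a i m)
    · obtain ⟨s, t, ht, rfl⟩ := (mem_spanPow_iff hi).1 hub
      rw [Function.update_self] at hu ⊢
      have hta : t ∈ spanPow x Finset.univ a :=
        spanPow_le_spanPow (Finset.erase_subset i _) (fun _ _ => le_rfl)
          (spanPow_erase_update_le ht)
      obtain ⟨r, hr⟩ := ih (Function.update a i 0) (by lia) s fun hs =>
        hu (add_mem (mul_mem_spanPow_of_mem_update (by lia) hs) hta)
      refine ⟨r, ?_⟩
      rw [← hprod 0 (m + 1) (by lia)]
      convert! add_mem (mul_mem_spanPow_of_mem_update (k := m + 1) (by lia) hr)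
        (Ideal.mul_mem_left _ r hta) using 1
      ring
    · obtain ⟨r, hr⟩ := ih _ (by lia) u hub
      refine ⟨r * x i, ?_⟩
      rw [← hprod m 1 (by lia)]
      convert! mul_mem_spanPow_of_mem_update (k := 1) (by lia) hr using 1
      ring

end SpanPow

end Ideal

/-! ### Classes in the Čech cohomology module. -/

namespace TopCech

section Cls

variable {R : Type*} [CommRing R] {n : ℕ} (x : Fin n → R)

theorem mk_eq_zero_iff {z : TopRing x} :
    (Submodule.Quotient.mk z : E x) = 0 ↔ z ∈ boundary x :=
  Submodule.Quotient.mk_eq_zero _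

theorem mk_mul_algebraMap (u : R) (d : ℕ) :
    (Localization.mk u ⟨(∏ j, x j) ^ d, d, rfl⟩ : TopRing x) *
      algebraMap R (TopRing x) ((∏ j, x j) ^ d) = algebraMap R (TopRing x) u := by
  rw [Localization.mk_eq_mk']
  exact IsLocalization.mk'_spec _ _ _

theorem isUnit_algebraMap_prod_pow (d : ℕ) :
    IsUnit (algebraMap R (TopRing x) ((∏ j, x j) ^ d)) := by
  rw [map_pow]
  exact (IsLocalization.Away.algebraMap_isUnit _).pow d

theorem smul_cls (r u : R) (d : ℕ) : r • cls x u d = cls x (r * u) d := by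
  rw [cls, cls, ← Submodule.Quotient.mk_smul, Localization.smul_mk, smul_eq_mul]

theorem cls_add (u v : R) (d : ℕ) : cls x (u + v) d = cls x u d + cls x v d := by
  rw [← mul_one u, ← mul_one v, ← add_mul]
  simp only [← smul_cls, add_smul]

theorem cls_mul_prod_pow (u : R) (d k : ℕ) :
    cls x (u * (∏ j, x j) ^ k) (d + k) = cls x u d := by
  rw [cls, cls]
  congr 1
  refine (isUnit_algebraMap_prod_pow x (d + k)).mul_right_cancel ?_
  rw [mk_mul_algebraMap, pow_add, map_mul, map_mul, ← mul_assoc, mk_mul_algebraMap]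

theorem exists_eq_cls (w : E x) : ∃ u d, w = cls x u d := by
  obtain ⟨z, rfl⟩ := Submodule.Quotient.mk_surjective _ w
  obtain ⟨u, ⟨_, d, rfl⟩, rfl⟩ := IsLocalization.exists_mk'_eq (Submonoid.powers (∏ j, x j)) z
  exact ⟨u, d, by rw [cls, Localization.mk_eq_mk']⟩

theorem algebraMap_prod_pow_eq_mul_face (i : Fin n) (d : ℕ) :
    algebraMap R (TopRing x) ((∏ j, x j) ^ d) = algebraMap R (TopRing x) (x i ^ d) *
      algebraMap R (TopRing x) ((∏ j ∈ Finset.univ.erase i, x j) ^ d) := by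
  rw [← map_mul, ← mul_pow, Finset.mul_prod_erase _ _ (Finset.mem_univ i)]

theorem cls_pow_eq_zero (i : Fin n) (d : ℕ) : cls x (x i ^ d) d = 0 := by
  refine (mk_eq_zero_iff x).2 (Submodule.mem_iSup_of_mem i
    ⟨IsLocalization.mk' _ 1 (⟨(∏ j ∈ Finset.univ.erase i, x j) ^ d, d, rfl⟩ :
      Submonoid.powers (∏ j ∈ Finset.univ.erase i, x j)), ?_⟩)
  refine (isUnit_algebraMap_prod_pow x d).mul_right_cancel ?_
  have h := congrArg (faceMap x i) (IsLocalization.mk'_spec (FaceRing x i) 1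
    (⟨(∏ j ∈ Finset.univ.erase i, x j) ^ d, d, rfl⟩ :
      Submonoid.powers (∏ j ∈ Finset.univ.erase i, x j)))
  rw [map_mul, AlgHom.commutes, map_one, map_one] at h
  rw [mk_mul_algebraMap, algebraMap_prod_pow_eq_mul_face x i d, mul_left_comm]
  exact (congrArg _ h).trans (mul_one _)

theorem cls_eq_zero_of_mem_spanPow {u : R} {d : ℕ}
    (hu : u ∈ Ideal.spanPow x Finset.univ (fun _ => d)) : cls x u (d + 1) = 0 := by
  have : Ideal.spanPow x Finset.univ (fun _ => d) ≤
      LinearMap.ker (LinearMap.toSpanSingleton R (E x) (cls x 1 (d + 1))) := by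
    refine Ideal.spanPow_le_iff.2 fun i _ => ?_
    rw [LinearMap.mem_ker, LinearMap.toSpanSingleton_apply, smul_cls, mul_one, cls_pow_eq_zero]
  simpa [smul_cls] using this hu

theorem exists_mul_eq_of_mem_boundary {z : TopRing x} (hz : z ∈ boundary x) :
    ∃ d, ∃ s ∈ Ideal.spanPow x Finset.univ (fun _ => d),
      z * algebraMap R (TopRing x) ((∏ j, x j) ^ (d + 1)) = algebraMap R (TopRing x) s := by
  refine Submodule.iSup_induction _ (motive := fun z => ∃ d, ∃ s ∈ Ideal.spanPow x Finset.univ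
    (fun _ => d), z * algebraMap R (TopRing x) ((∏ j, x j) ^ (d + 1)) =
      algebraMap R (TopRing x) s) hz ?_ ⟨0, 0, zero_mem _, by rw [zero_mul, map_zero]⟩ ?_
  · rintro i _ ⟨w, rfl⟩
    obtain ⟨d, v, hv⟩ := IsLocalization.Away.surj (∏ j ∈ Finset.univ.erase i, x j) w
    -- The extra face product raises the cleared denominator from exponent d to d + 1.
    refine ⟨d, x i ^ (d + 1) * (v * ∏ j ∈ Finset.univ.erase i, x j),
      Ideal.mul_mem_right _ _ (Ideal.pow_mem_spanPow (Finset.mem_univ i) le_rfl), ?_⟩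
    have h := congrArg (faceMap x i) hv
    rw [← map_pow, map_mul, AlgHom.commutes, AlgHom.commutes] at h
    rw [algebraMap_prod_pow_eq_mul_face x i, pow_succ (∏ j ∈ _, x j), map_mul, map_mul, map_mul,
      ← h, AlgHom.toLinearMap_apply]
    ring
  · rintro z₁ z₂ ⟨d₁, s₁, h₁, e₁⟩ ⟨d₂, s₂, h₂, e₂⟩
    refine ⟨d₁ + (d₂ + 1), s₁ * (∏ j, x j) ^ (d₂ + 1) + s₂ * (∏ j, x j) ^ (d₁ + 1),
      add_mem (Ideal.mul_prod_pow_mem_spanPow h₁) ?_, ?_⟩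
    · convert! Ideal.mul_prod_pow_mem_spanPow h₂ using 2
      funext
      ring
    · rw [map_add, map_mul, map_mul, ← e₁, ← e₂, show d₁ + (d₂ + 1) + 1 = (d₁ + 1) + (d₂ + 1) by ring,
        pow_add, map_mul]
      ring

theorem eq_top_of_forall_cls_one_mem {p : ℕ} (hp : 1 < p) {N : Submodule R (E x)}
    (h : ∀ e, cls x 1 (p ^ e) ∈ N) : N = ⊤ := by
  refine eq_top_iff.2 fun w _ => ?_
  obtain ⟨u, d, rfl⟩ := exists_eq_cls x w
  have hd : d + (p ^ d - d) = p ^ d := Nat.add_sub_cancel' (Nat.lt_pow_self hp).le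
  rw [← cls_mul_prod_pow x u d (p ^ d - d), hd, ← mul_one (_ * _), ← smul_cls]
  exact N.smul_mem _ (h d)

end Cls

/-! ### Composition of the maps hF^e. -/

section Frobenius

variable {R : Type*} [CommRing R] {n : ℕ} (x : Fin n → R) (p : ℕ) [ExpChar R p]

theorem iterate_FE_cls (e : ℕ) (u : R) (d : ℕ) :
    (FE p x)^[e] (cls x u d) = cls x (u ^ p ^ e) (p ^ e * d) := by
  induction e with
  | zero => simp
  | succ e ih =>
    rw [Function.iterate_succ_apply', ih, FE_cls, ← pow_mul, ← pow_succ, ← mul_assoc, ← pow_succ']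

theorem smul_iterate_FE_smul_iterate_FE (g h : R) (k e : ℕ) (w : E x) :
    g • (FE p x)^[k] (h • (FE p x)^[e] w) = (g * h ^ p ^ k) • (FE p x)^[k + e] w := by
  rw [iterate_FE_smul, ← Function.iterate_add_apply, smul_smul]

omit [ExpChar R p] in
-- Because p^k⌈cp^e⌉ is an integer at least cp^(k+e).
theorem pow_mem_pow_ceil {a : Ideal R} {c : ℝ} {e k : ℕ} {h : R}
    (hh : h ∈ a ^ ⌈c * (p : ℝ) ^ e⌉₊) : h ^ p ^ k ∈ a ^ ⌈c * (p : ℝ) ^ (k + e)⌉₊ := by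
  refine Ideal.pow_le_pow_right ?_ (pow_mul a _ (p ^ k) ▸ Ideal.pow_mem_pow hh (p ^ k))
  refine Nat.ceil_le.2 ?_
  push_cast
  rw [pow_add, mul_left_comm, mul_comm]
  exact mul_le_mul_of_nonneg_right (Nat.le_ceil _) (by positivity)

variable {x p}

theorem mem_Z_iff {a : Ideal R} {c : ℝ} {w : E x} :
    w ∈ Z p x a c ↔ ∀ e, 1 ≤ e → ∀ h ∈ a ^ ⌈c * (p : ℝ) ^ e⌉₊, h • (FE p x)^[e] w = 0 := by
  simp only [Z, Submodule.mem_iInf]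
  rfl

theorem isInvariant_Z (a : Ideal R) (c : ℝ) : IsInvariant p x a c (Z p x a c) := by
  intro e he h hh w hw
  refine mem_Z_iff.2 fun k hk g _ => ?_
  rw [smul_iterate_FE_smul_iterate_FE, mul_smul,
    mem_Z_iff.1 hw (k + e) (by lia) _ (pow_mem_pow_ceil p hh), smul_zero]

end Frobenius

/-! ### The socle of E, and maximality and properness of Z_c. -/

section Regular

variable {R : Type*} [CommRing R] [IsLocalRing R] [IsNoetherianRing R] {n : ℕ} {x : Fin n → R}

theorem cls_one_one_ne_zero (hn : ringKrullDim R = n)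
    (hx : Ideal.span (Set.range x) = maximalIdeal R) : cls x 1 1 ≠ 0 := by
  intro h
  obtain ⟨d, s, hs, h⟩ := exists_mul_eq_of_mem_boundary x ((mk_eq_zero_iff x).1 h)
  have h1 : algebraMap R (TopRing x) ((∏ j, x j) ^ d) = algebraMap R (TopRing x) s := by
    rw [← h, add_comm d 1, pow_add, map_mul, ← mul_assoc, mk_mul_algebraMap, map_one, one_mul]
  -- Equality in the localization costs a factor (∏ x)^k, which is absorbed by raising d to d + k.
  obtain ⟨⟨_, k, rfl⟩, hk⟩ :=
    (IsLocalization.eq_iff_exists (Submonoid.powers (∏ j, x j)) (TopRing x)).1 h1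
  have hk' : (∏ j, x j) ^ (d + k) = s * (∏ j, x j) ^ k := by
    rw [pow_add, mul_comm, mul_comm s]
    exact hk
  refine Ideal.prod_pow_notMem_spanPow (fun S j hj u => mem_span_image_of_mul_mem hn hx hj)
    (hx ▸ (maximalIdeal.isMaximal R).ne_top) (d + k) Finset.univ ?_
  simp only [Finset.mem_univ, if_true]
  rw [Finset.prod_pow, hk']
  exact Ideal.mul_prod_pow_mem_spanPow hs

omit [IsNoetherianRing R] in
theorem exists_smul_eq_cls_one_one
    (hx : Ideal.span (Set.range x) = maximalIdeal R) {u : R} {d : ℕ}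
    (hu : u ∉ Ideal.spanPow x Finset.univ (fun _ => d)) :
    ∃ r : R, r • cls x u (d + 1) = cls x 1 1 := by
  obtain ⟨r, hr⟩ := Ideal.exists_mul_sub_prod_pow_mem_spanPow hx _ _ (Nat.lt_succ_self _) u hu
  refine ⟨r, ?_⟩
  rw [Finset.prod_pow] at hr
  rw [smul_cls, ← sub_add_cancel (r * u) ((∏ j, x j) ^ d), cls_add,
    cls_eq_zero_of_mem_spanPow x hr, zero_add, add_comm d, ← cls_mul_prod_pow x 1 1 d, one_mul]

omit [IsNoetherianRing R] in
theorem exists_smul_eq_cls_one_one_of_ne_zero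
    (hx : Ideal.span (Set.range x) = maximalIdeal R) {w : E x} (hw : w ≠ 0) :
    ∃ r : R, r • w = cls x 1 1 := by
  obtain ⟨u, d, rfl⟩ := exists_eq_cls x w
  rw [← cls_mul_prod_pow x u d 1] at hw ⊢
  exact exists_smul_eq_cls_one_one hx fun h => hw (cls_eq_zero_of_mem_spanPow x h)

theorem mem_spanPow_of_cls_eq_zero (hn : ringKrullDim R = n)
    (hx : Ideal.span (Set.range x) = maximalIdeal R) {u : R} {d : ℕ} (h : cls x u (d + 1) = 0) :
    u ∈ Ideal.spanPow x Finset.univ (fun _ => d) := by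
  by_contra hu
  obtain ⟨r, hr⟩ := exists_smul_eq_cls_one_one hx hu
  rw [h, smul_zero] at hr
  exact cls_one_one_ne_zero hn hx hr.symm

variable {p : ℕ} [ExpChar R p] {a : Ideal R} {c : ℝ}

omit [IsNoetherianRing R] in
theorem le_Z_of_isInvariant (hp : 1 < p) (hx : Ideal.span (Set.range x) = maximalIdeal R)
    {N : Submodule R (E x)} (hN : IsInvariant p x a c N) (hN' : N ≠ ⊤) : N ≤ Z p x a c := by
  intro w hw
  refine mem_Z_iff.2 fun e he h hh => ?_
  by_contra hne
  obtain ⟨r, hr⟩ := exists_smul_eq_cls_one_one_of_ne_zero hx hne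
  refine hN' (eq_top_of_forall_cls_one_mem x hp fun k => ?_)
  have h1 : cls x 1 (p ^ k) = (FE p x)^[k] (cls x 1 1) := by
    rw [iterate_FE_cls, one_pow, mul_one]
  rw [h1, ← hr, iterate_FE_smul, ← one_smul R ((FE p x)^[k] _), smul_iterate_FE_smul_iterate_FE,
    one_mul]
  exact N.smul_mem _ (hN (k + e) (by lia) _ (pow_mem_pow_ceil p hh) w hw)

theorem Z_ne_top [IsDomain R] (hp : 1 < p) (hn : ringKrullDim R = n)
    (hx : Ideal.span (Set.range x) = maximalIdeal R) (ha : a ≠ ⊥) : Z p x a c ≠ ⊤ := by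
  intro htop
  refine pow_ne_zero ⌈c * (p : ℝ) ^ 1⌉₊ ha (eq_bot_iff.2 fun h hh => ?_)
  rw [← Ideal.iInf_pow_eq_bot_of_isLocalRing (maximalIdeal R) (maximalIdeal.isMaximal R).ne_top]
  refine Submodule.mem_iInf _ |>.2 fun d => ?_
  -- The level e = 1 suffices: letting d grow puts h in every 𝔪^d.
  have h0 := mem_Z_iff.1 (htop ▸ Submodule.mem_top : cls x 1 (d + 1) ∈ Z p x a c) 1 le_rfl h hh
  rw [iterate_FE_cls, one_pow, pow_one, smul_cls, mul_one,
    show p * (d + 1) = (p * (d + 1) - 1) + 1 by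
      have := Nat.mul_pos (by lia : 0 < p) d.succ_pos
      lia] at h0
  refine Ideal.spanPow_le_iff.2 (fun i _ => ?_) (mem_spanPow_of_cls_eq_zero hn hx h0)
  refine Ideal.pow_le_pow_right ?_
    (Ideal.pow_mem_pow (hx ▸ Ideal.subset_span (Set.mem_range_self i)) _)
  have := Nat.mul_le_mul_right (d + 1) hp.le
  lia

end Regular

end TopCech

theorem mainTheorem7 {R : Type*} [CommRing R] [IsRegularLocalRing R]
    (p : ℕ) [Fact p.Prime] [CharP R p]
    (n : ℕ) (hn : ringKrullDim R = n)
    (x : Fin n → R) (hx : Ideal.span (Set.range x) = maximalIdeal R)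
    (a : Ideal R) (ha0 : a ≠ ⊥) (ham : a ≤ maximalIdeal R)
    (c : ℝ) (hc : 0 < c) :
    IsGreatest {N : Submodule R (TopCech.E x) | N ≠ ⊤ ∧ TopCech.IsInvariant p x a c N}
        (TopCech.Z p x a c) ∧
      ∀ N : Submodule R (TopCech.E x),
        Maximal (fun N' => N' ≠ ⊤ ∧ TopCech.IsInvariant p x a c N') N ↔
          N = TopCech.Z p x a c := by
  have hp : 1 < p := (Fact.out : p.Prime).one_lt
  have : IsDomain R := by
    -- With no parameters, primality says that (0) is prime.
    have h := isPrime_span_image hn hx ∅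
    rw [Finset.coe_empty, Set.image_empty, Ideal.span_empty] at h
    exact IsDomain.of_bot_isPrime R
  have hZ : IsGreatest {N : Submodule R (TopCech.E x) | N ≠ ⊤ ∧ TopCech.IsInvariant p x a c N}
      (TopCech.Z p x a c) :=
    ⟨⟨TopCech.Z_ne_top hp hn hx ha0, TopCech.isInvariant_Z a c⟩,
      fun N hN => TopCech.le_Z_of_isInvariant hp hx hN.2 hN.1⟩
  refine ⟨hZ, fun N => ⟨fun hN => hN.eq_of_le hZ.1 (hZ.2 hN.prop), ?_⟩⟩
  rintro rfl
  exact ⟨hZ.1, fun N hN _ => hZ.2 hN⟩
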